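/- Let $d\ge 1$ and $\lambda>0$, let $\mathbb{H}^{d+1}$ be the $(d+1)$-dimensional hyperbolic space of constant curvature $-1$ with distance $d(\cdot,\cdot)$, volume measure $\mathrm{Vol}$ and a fixed origin $0$, and let $\mathcal{N}$ be a homogeneous Poisson point process of intensity $\lambda$ on $\mathbb{H}^{d+1}$ (that is, with intensity measure $\lambda\,\mathrm{Vol}$). A parent of $z\in\mathcal{N}$ is a point $a$ that minimizes $d(a,z)$ among all points $a\in\mathcal{N}\cup\{0\}$ with $d(0,a)<d(0,z)$. The radial spanning tree (RST) of $\mathcal{N}$ is the graph with vertex set $\mathcal{N}\cup\{0\}$ whose edges join each $z\in\mathcal{N}$ to its parent. Then, almost surely, the following hold. 1. Every $z\in\mathcal{N}$ has exactly one parent, denoted $A(z)$. 2. The RST is a tree (connected and without cycles), and each of its vertices has finite degree. 3. If $d=1$, representing the edges by the hyperbolic geodesic segments $[z,A(z)]$, $z\in\mathcal{N}$, gives a planar embedding: for any two distinct points $z_1,z_2\in\mathcal{N}$, the segments $[z_1,A(z_1)]$ and $[z_2,A(z_2)]$ meet, if at all, only at a common endpoint, that is, $[z_1,A(z_1)]\cap[z_2,A(z_2)]\subseteq\{z_1,A(z_1)\}\cap\{z_2,A(z_2)\}$.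 -/

import Mathlib

open MeasureTheory ProbabilityTheory
open scoped NNReal ENNReal

noncomputable section

/-! ### Hyperbolic space

The hyperboloid model: the upper sheet `{(t, x) : t ^ 2 - ‖x‖ ^ 2 = 1, 0 < t}` in `ℝ × ℝⁿ`,
a point being recorded by its spatial part `x`, which determines `t = √(1 + ‖x‖ ^ 2)`.
In polar coordinates around the origin, the point at hyperbolic distance `r` from the origin in
the direction of the unit vector `u` is `x = sinh r • u`, and `t = cosh r`. -/

/-- The `n`-dimensional hyperbolic space of curvature `-1` (hyperboloid model, a point being given
by its spatial part). Its Borel structure is that of `ℝⁿ`; its distance is `HypSpace.hdist`,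
not the Euclidean `dist`. The origin is `0`. -/
abbrev HypSpace (n : ℕ) : Type := EuclideanSpace ℝ (Fin n)

namespace HypSpace

variable {n : ℕ}

/-- The time coordinate of a point of the hyperboloid. -/
def time (x : HypSpace n) : ℝ := Real.sqrt (1 + ‖x‖ ^ 2)

/-- The hyperbolic distance: `cosh d(x, y)` is the Lorentz product of `(t, x)` and `(s, y)`. In
polar coordinates this is the hyperbolic law of cosines
`cosh d = cosh r₁ * cosh r₂ - ⟪u₁, u₂⟫ * sinh r₁ * sinh r₂`. -/
def hdist (x y : HypSpace n) : ℝ := Real.arcosh (time x * time y - inner ℝ x y)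

/-- The hyperbolic volume measure, `dx / √(1 + ‖x‖ ^ 2)` on the hyperboloid; in polar coordinates
this is `sinh r ^ (n - 1) dr dν(u)`. -/
def hvol (n : ℕ) : Measure (HypSpace n) :=
  (volume : Measure (EuclideanSpace ℝ (Fin n))).withDensity
    (fun x => ENNReal.ofReal (1 / time x))

/-- The geodesic segment `[x, y]`: the points lying between `x` and `y` for the hyperbolic
distance. -/
def geodesicSegment (x y : HypSpace n) : Set (HypSpace n) :=
  {p | hdist x p + hdist p y = hdist x y}

end HypSpace

/-! ### Poisson point processes -/

/-- `N` is a (simple) Poisson point process on `E` with intensity measure `μ`: a random set whose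
numbers of points in measurable sets are random variables, which are Poisson of parameter `μ B` on
each `B` of finite measure, and independent on pairwise disjoint sets. (If `μ` is finite on bounded
sets, then almost surely `N` has finitely many points in every bounded set.) -/
structure IsPoissonPointProcess {Ω E : Type*} [MeasurableSpace Ω] [MeasurableSpace E]
    (P : Measure Ω) (μ : Measure E) (N : Ω → Set E) : Prop where
  measurable_count : ∀ B : Set E, MeasurableSet B → Measurable fun ω => (N ω ∩ B).encard
  law_count : ∀ B : Set E, MeasurableSet B → μ B ≠ ∞ →
    P.map (fun ω => (N ω ∩ B).encard) =
      (poissonMeasure (μ B).toNNReal).map (Nat.cast : ℕ → ℕ∞)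
  indep_count : ∀ (k : ℕ) (B : Fin k → Set E), (∀ i, MeasurableSet (B i)) →
    Pairwise (fun i j => Disjoint (B i) (B j)) →
    iIndepFun (fun i ω => (N ω ∩ B i).encard) P

/-! ### The radial spanning tree -/

namespace RST

open HypSpace

variable {n : ℕ}

/-- `a` is a parent of `z ∈ S`: a nearest point to `z` among the points of `S ∪ {0}` that are
strictly closer to the origin than `z`. -/
def IsParent (S : Set (HypSpace n)) (z a : HypSpace n) : Prop :=
  z ∈ S ∧ a ∈ insert 0 S ∧ hdist 0 a < hdist 0 z ∧
    ∀ w ∈ insert 0 S, hdist 0 w < hdist 0 z → hdist z a ≤ hdist z w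

/-- The radial spanning tree of `S`: the graph on `S ∪ {0}` joining each `z ∈ S` to its parent. -/
def graph (S : Set (HypSpace n)) : SimpleGraph ↥(insert (0 : HypSpace n) S) where
  Adj u v := IsParent S u v ∨ IsParent S v u
  symm := ⟨fun _ _ h => h.symm⟩
  loopless := ⟨fun _ h => h.elim (fun h => lt_irrefl _ h.2.2.1) (fun h => lt_irrefl _ h.2.2.1)⟩

end RST

end

/-!
The deterministic part is carried out in Minkowski space. For points of the hyperboloid,
`HypSpace.lorentz x y = cosh d(x, y)` is bilinear in the two vectors `(t, x)`, and a geodesic segment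
consists of nonnegative combinations of its end points
(`HypSpace.exists_isComb_of_mem_geodesicSegment`). If two edges `[z₁, a₁]` and `[z₂, a₂]` have a
common point `P = α Z₁ + β A₁ = γ Z₂ + δ A₂`, evaluating the linear forms `lorentz 0 ·`,
`lorentz z₂ ·`, `lorentz a₁ ·`, `lorentz a₂ ·` on both expressions contradicts the choice of the
parents unless `P` is a common end point (`RST.eq_or_eq_of_isComb`). No randomness and no restriction
on the dimension are needed for this.

Parents are strictly closer to the origin, and balls contain finitely many points. Hence parents
exist, every vertex is connected to the origin, and, parents being unique, there are no cycles: the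
vertex of a cycle that is farthest from the origin would have two parents. Uniqueness of parents
amounts to the absence of ties `d(z, a) = d(z, b)`. Hyperbolic spheres are Lebesgue null, so the
triples forming a tie are null for the third power of the intensity measure, and almost surely no
tuple of distinct points of a Poisson process falls into such a null set
(`IsPoissonPointProcess.ae_notMem_of_pi_null`): cover the null set by boxes of small total measure
with disjoint sides and use independence.

For the degrees: if `v` had infinitely many children, they would accumulate at a point `ξ` at
infinity, and a point of the process inside the horoball centred at `ξ` through `v` would be nearer
than `v` to all the children close to `ξ` (`RST.finite_children`). That all horoballs contain points
of the process follows from a union bound. A horoball of given size contains, for large `m`, one of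
polynomially many tubes, each of which is empty with a probability that is exponentially small in
`m` (`IsPoissonPointProcess.ae_exists_mem_horoball`).
-/

/-! ### Null sets of tuples of points of a Poisson process -/

namespace IsPoissonPointProcess

variable {Ω E : Type*} [MeasurableSpace Ω] [MeasurableSpace E] {P : Measure Ω} {μ : Measure E}
  {N : Ω → Set E}

theorem measurableSet_count_eq_zero (hN : IsPoissonPointProcess P μ N) {B : Set E}
    (hB : MeasurableSet B) : MeasurableSet {ω | (N ω ∩ B).encard = 0} :=
  hN.measurable_count B hB (measurableSet_singleton 0)

theorem prob_count_eq_zero (hN : IsPoissonPointProcess P μ N) {B : Set E}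
    (hB : MeasurableSet B) (hfin : μ B ≠ ∞) :
    P {ω | (N ω ∩ B).encard = 0} = ENNReal.ofReal (Real.exp (-(μ B).toReal)) := by
  have h := hN.law_count B hB hfin
  have h1 : P {ω | (N ω ∩ B).encard = 0} =
      P.map (fun ω => (N ω ∩ B).encard) {0} := by
    rw [Measure.map_apply (hN.measurable_count B hB) (measurableSet_singleton 0)]
    rfl
  have h2 : (Nat.cast : ℕ → ℕ∞) ⁻¹' {0} = {0} := by
    ext n
    simp
  rw [h1, h, Measure.map_apply (by fun_prop) (measurableSet_singleton 0), h2,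
    poissonMeasure_singleton]
  simp [ENNReal.toReal]

theorem prob_count_eq_top (hN : IsPoissonPointProcess P μ N) {B : Set E}
    (hB : MeasurableSet B) (hfin : μ B ≠ ∞) :
    P {ω | (N ω ∩ B).encard = ⊤} = 0 := by
  have h := hN.law_count B hB hfin
  have h1 : P {ω | (N ω ∩ B).encard = ⊤} =
      P.map (fun ω => (N ω ∩ B).encard) {⊤} := by
    rw [Measure.map_apply (hN.measurable_count B hB) (measurableSet_singleton _)]
    rfl
  have h2 : (Nat.cast : ℕ → ℕ∞) ⁻¹' {⊤} = ∅ := by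
    ext n
    simp
  rw [h1, h, Measure.map_apply (by fun_prop) (measurableSet_singleton _), h2, measure_empty]

theorem ae_finite_inter (hN : IsPoissonPointProcess P μ N) {B : Set E}
    (hB : MeasurableSet B) (hfin : μ B ≠ ∞) : ∀ᵐ ω ∂P, (N ω ∩ B).Finite := by
  have h := hN.prob_count_eq_top hB hfin
  rw [measure_eq_zero_iff_ae_notMem] at h
  filter_upwards [h] with ω hω
  exact Set.encard_ne_top_iff.1 hω

/-- The probability of a nonempty set is at most the expected number of points in it. -/
theorem prob_nonempty_le [IsProbabilityMeasure P] (hN : IsPoissonPointProcess P μ N) {B : Set E}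
    (hB : MeasurableSet B) : P {ω | (N ω ∩ B).encard ≠ 0} ≤ μ B := by
  by_cases hfin : μ B = ∞
  · simp [hfin]
  have hc : {ω | (N ω ∩ B).encard ≠ 0} = {ω | (N ω ∩ B).encard = 0}ᶜ := rfl
  rw [hc, prob_compl_eq_one_sub (hN.measurableSet_count_eq_zero hB), hN.prob_count_eq_zero hB hfin,
    tsub_le_iff_right]
  have h1 := Real.add_one_le_exp (-(μ B).toReal)
  calc (1 : ℝ≥0∞) = ENNReal.ofReal 1 := by simp
    _ ≤ ENNReal.ofReal ((μ B).toReal + Real.exp (-(μ B).toReal)) :=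
        ENNReal.ofReal_le_ofReal (by linarith)
    _ = μ B + ENNReal.ofReal (Real.exp (-(μ B).toReal)) := by
        rw [ENNReal.ofReal_add ENNReal.toReal_nonneg (Real.exp_pos _).le,
          ENNReal.ofReal_toReal hfin]

theorem prob_forall_nonempty_le [IsProbabilityMeasure P] (hN : IsPoissonPointProcess P μ N) {k : ℕ}
    {B : Fin k → Set E} (hB : ∀ i, MeasurableSet (B i))
    (hd : Pairwise fun i j => Disjoint (B i) (B j)) :
    P {ω | ∀ i, (N ω ∩ B i).Nonempty} ≤ ∏ i, μ (B i) := by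
  have h := (hN.indep_count k B hB hd).measure_inter_preimage_eq_mul Finset.univ
    (sets := fun _ => {0}ᶜ) (fun i _ => (measurableSet_singleton 0).compl)
  have he : {ω | ∀ i, (N ω ∩ B i).Nonempty} =
      ⋂ i ∈ Finset.univ, (fun ω => (N ω ∩ B i).encard) ⁻¹' {0}ᶜ := by
    ext ω
    simp [Set.nonempty_iff_ne_empty]
  rw [he, h]
  exact Finset.prod_le_prod' fun i _ => hN.prob_nonempty_le (hB i)

/-- A null set for the product outer measure is covered by boxes of small total measure. With the
sides of the boxes cut down to disjoint sets `U i`, independence bounds the probability that a box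
is hit by the measure of the box. -/
theorem ae_notMem_of_pi_null_of_disjoint [IsProbabilityMeasure P]
    (hN : IsPoissonPointProcess P μ N) [SigmaFinite μ] {k : ℕ} {T : Set (Fin k → E)}
    (hT : Measure.pi (fun _ => μ) T = 0) {U : Fin k → Set E} (hU : ∀ i, MeasurableSet (U i))
    (hd : Pairwise fun i j => Disjoint (U i) (U j)) :
    ∀ᵐ ω ∂P, ∀ x : Fin k → E, (∀ i, x i ∈ N ω ∩ U i) → x ∉ T := by
  have hbad : P {ω | ∃ x : Fin k → E, (∀ i, x i ∈ N ω ∩ U i) ∧ x ∈ T} = 0 := by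
    refine le_antisymm (le_of_forall_gt fun ε hε => ?_) zero_le
    obtain ⟨T', hTT', hT'm, hT'0⟩ := exists_measurable_superset_of_null hT
    rw [Measure.pi, toMeasure_apply _ _ hT'm, OuterMeasure.pi, OuterMeasure.boundedBy_apply] at hT'0
    have hlt := hT'0.trans_lt hε
    simp only [iInf_lt_iff] at hlt
    obtain ⟨t, hcov, hsum⟩ := hlt
    -- a measurable box containing the part of `t n` inside the box `U`
    let B : ℕ → Fin k → Set E := fun n i => toMeasurable μ (Function.eval i '' t n) ∩ U i
    have hsub : {ω | ∃ x : Fin k → E, (∀ i, x i ∈ N ω ∩ U i) ∧ x ∈ T} ⊆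
        ⋃ n, {ω | (t n).Nonempty ∧ ∀ i, (N ω ∩ B n i).Nonempty} := by
      rintro ω ⟨x, hx, hxT⟩
      obtain ⟨n, hn⟩ := Set.mem_iUnion.1 (hcov (hTT' hxT))
      refine Set.mem_iUnion.2 ⟨n, ⟨x, hn⟩, fun i => ⟨x i, (hx i).1, ?_, (hx i).2⟩⟩
      exact subset_toMeasurable _ _ ⟨x, hn, rfl⟩
    refine (measure_mono hsub).trans_lt ((measure_iUnion_le _).trans_lt ?_)
    refine lt_of_le_of_lt (ENNReal.tsum_le_tsum fun n => ?_) hsum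
    by_cases hne : (t n).Nonempty
    · simp only [hne, true_and, iSup_pos]
      refine (hN.prob_forall_nonempty_le (B := B n)
        (fun i => (measurableSet_toMeasurable _ _).inter (hU i))
        (fun i j hij => (hd hij).mono Set.inter_subset_right Set.inter_subset_right)).trans ?_
      refine Finset.prod_le_prod' fun i _ => ?_
      exact (measure_mono Set.inter_subset_left).trans (measure_toMeasurable _).le
    · simp [hne]
  rw [measure_eq_zero_iff_ae_notMem] at hbad
  filter_upwards [hbad] with ω hω x hx hxT
  exact hω ⟨x, hx, hxT⟩

/-- Almost surely, no `k`-tuple of distinct points of a Poisson process lies in a set that is null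
for the `k`-fold product of the intensity measure. -/
theorem ae_notMem_of_pi_null [IsProbabilityMeasure P] [TopologicalSpace E]
    [SecondCountableTopology E] [T2Space E] [OpensMeasurableSpace E]
    (hN : IsPoissonPointProcess P μ N) [SigmaFinite μ] {k : ℕ} {T : Set (Fin k → E)}
    (hT : Measure.pi (fun _ => μ) T = 0) :
    ∀ᵐ ω ∂P, ∀ x : Fin k → E, Function.Injective x → (∀ i, x i ∈ N ω) → x ∉ T := by
  have hb := TopologicalSpace.isBasis_countableBasis E
  have hcount := TopologicalSpace.countable_countableBasis E
  have : Countable (TopologicalSpace.countableBasis E) := hcount.to_subtype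
  have hall : ∀ U : Fin k → TopologicalSpace.countableBasis E, ∀ᵐ ω ∂P,
      (Pairwise fun i j => Disjoint (U i : Set E) (U j)) →
        ∀ x : Fin k → E, (∀ i, x i ∈ N ω ∩ U i) → x ∉ T := by
    intro U
    by_cases hd : Pairwise fun i j => Disjoint (U i : Set E) (U j)
    · filter_upwards [hN.ae_notMem_of_pi_null_of_disjoint hT
        (fun i => (hb.isOpen (U i).2).measurableSet) hd] with ω hω _ using hω
    · exact Filter.Eventually.of_forall fun ω h => absurd h hd
  filter_upwards [ae_all_iff.2 hall] with ω hω x hinj hx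
  obtain ⟨V, hV, hVd⟩ := (Set.finite_range x).t2_separation
  choose U hUb hxU hUV using fun i =>
    hb.exists_subset_of_mem_open (hV (x i)).1 (hV (x i)).2
  refine hω (fun i => ⟨U i, hUb i⟩) (fun i j hij => ?_) x fun i => ⟨hx i, hxU i⟩
  exact (hVd ⟨i, rfl⟩ ⟨j, rfl⟩ (hinj.ne hij)).mono (hUV i) (hUV j)

end IsPoissonPointProcess

/-- A measurable set of tuples is null for a power of `μ` if all its sections in the last
coordinate are null. -/
theorem MeasureTheory.Measure.pi_null_of_snoc_null {E : Type*} [MeasurableSpace E] {μ : Measure E}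
    [SigmaFinite μ] {k : ℕ} {T : Set (Fin (k + 1) → E)} (hT : MeasurableSet T)
    (h : ∀ x : Fin k → E, μ {y | (Fin.snoc x y : Fin (k + 1) → E) ∈ T} = 0) :
    Measure.pi (fun _ => μ) T = 0 := by
  have hmp := (measurePreserving_piFinSuccAbove (fun _ : Fin (k + 1) => μ) (Fin.last k)).symm
  have hT' := (MeasurableEquiv.piFinSuccAbove (fun _ => E) (Fin.last k)).symm.measurable hT
  rw [← hmp.measure_preimage hT.nullMeasurableSet, Measure.prod_apply_symm hT']
  rw [lintegral_eq_zero_of_ae_eq_zero]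
  filter_upwards with x
  convert h x using 2
  ext y
  simp [MeasurableEquiv.piFinSuccAbove, Fin.insertNthEquiv, Fin.insertNth_last']
  rfl

/-! ### Minkowski geometry of the hyperboloid -/

namespace HypSpace

variable {n : ℕ}

/-- The Lorentz product of two points of the hyperboloid, with the sign that makes it positive: it
is `cosh (hdist x y)`. -/
noncomputable def lorentz (x y : HypSpace n) : ℝ := time x * time y - inner ℝ x y

theorem time_sq (x : HypSpace n) : time x ^ 2 = 1 + ‖x‖ ^ 2 := by
  rw [time, Real.sq_sqrt (by positivity)]

theorem time_pos (x : HypSpace n) : 0 < time x := Real.sqrt_pos.2 (by positivity)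

theorem one_le_time (x : HypSpace n) : 1 ≤ time x := by
  have := time_sq x
  nlinarith [time_pos x, sq_nonneg ‖x‖]

theorem norm_lt_time (x : HypSpace n) : ‖x‖ < time x := by
  have := time_sq x
  nlinarith [time_pos x, norm_nonneg x]

@[simp] theorem time_zero : time (0 : HypSpace n) = 1 := by simp [time]

theorem time_lt_time {x y : HypSpace n} : time x < time y ↔ ‖x‖ < ‖y‖ := by
  rw [← sq_lt_sq₀ (time_pos x).le (time_pos y).le, time_sq, time_sq, add_lt_add_iff_left,
    sq_lt_sq₀ (norm_nonneg x) (norm_nonneg y)]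

theorem continuous_time : Continuous (time : HypSpace n → ℝ) := by
  unfold time
  fun_prop

theorem continuous_lorentz_comp {X : Type*} [TopologicalSpace X] {f g : X → HypSpace n}
    (hf : Continuous f) (hg : Continuous g) : Continuous fun x => lorentz (f x) (g x) :=
  ((continuous_time.comp hf).mul (continuous_time.comp hg)).sub (hf.inner hg)

theorem continuous_lorentz (x : HypSpace n) : Continuous (lorentz x) :=
  continuous_lorentz_comp continuous_const continuous_id

theorem lorentz_comm (x y : HypSpace n) : lorentz x y = lorentz y x := by
  rw [lorentz, lorentz, real_inner_comm, mul_comm]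

@[simp] theorem lorentz_zero_left (x : HypSpace n) : lorentz 0 x = time x := by simp [lorentz]

@[simp] theorem lorentz_zero_right (x : HypSpace n) : lorentz x 0 = time x := by simp [lorentz]

@[simp] theorem lorentz_self (x : HypSpace n) : lorentz x x = 1 := by
  rw [lorentz, real_inner_self_eq_norm_sq]
  linarith [time_sq x, sq (time x)]

theorem one_lt_lorentz {x y : HypSpace n} (h : x ≠ y) : 1 < lorentz x y := by
  have h1 : 0 < ‖x - y‖ ^ 2 := by
    have := norm_pos_iff.2 (sub_ne_zero.2 h)
    positivity
  rw [norm_sub_sq_real] at h1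
  have hcs := abs_le.1 (abs_real_inner_le_norm x y)
  have h2 : inner ℝ x y ^ 2 ≤ (‖x‖ * ‖y‖) ^ 2 := sq_le_sq' hcs.1 hcs.2
  have h3 : (1 + inner ℝ x y) ^ 2 < (time x * time y) ^ 2 := by
    rw [mul_pow, time_sq, time_sq]
    nlinarith
  have h4 := abs_lt_of_sq_lt_sq h3 (mul_pos (time_pos x) (time_pos y)).le
  rw [lorentz]
  linarith [(abs_lt.1 h4).2]

theorem one_le_lorentz (x y : HypSpace n) : 1 ≤ lorentz x y := by
  by_cases h : x = y
  · simp [h]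
  · exact (one_lt_lorentz h).le

theorem cosh_hdist (x y : HypSpace n) : Real.cosh (hdist x y) = lorentz x y :=
  Real.cosh_arcosh (one_le_lorentz x y)

theorem hdist_nonneg (x y : HypSpace n) : 0 ≤ hdist x y := Real.arcosh_nonneg (one_le_lorentz x y)

theorem hdist_le_hdist {x y z w : HypSpace n} :
    hdist x y ≤ hdist z w ↔ lorentz x y ≤ lorentz z w :=
  Real.arcosh_le_arcosh (zero_lt_one.trans_le (one_le_lorentz x y))
    (zero_lt_one.trans_le (one_le_lorentz z w))

theorem hdist_lt_hdist {x y z w : HypSpace n} :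
    hdist x y < hdist z w ↔ lorentz x y < lorentz z w := by
  rw [← not_le, hdist_le_hdist, not_le]

theorem hdist_pos {x y : HypSpace n} (h : x ≠ y) : 0 < hdist x y :=
  Real.arcosh_pos (one_lt_lorentz h)

/-- The point `p` of the hyperboloid is the combination `α X + β Y` of the points `x` and `y`, as
vectors of Minkowski space. -/
def IsComb (p x y : HypSpace n) (α β : ℝ) : Prop :=
  time p = α * time x + β * time y ∧ p = α • x + β • y

theorem IsComb.lorentz_left {p x y : HypSpace n} {α β : ℝ} (h : IsComb p x y α β)
    (w : HypSpace n) : lorentz p w = α * lorentz x w + β * lorentz y w := by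
  have h2 : inner ℝ p w = α * inner ℝ x w + β * inner ℝ y w := by
    rw [h.2, inner_add_left, real_inner_smul_left, real_inner_smul_left]
  simp only [lorentz, h.1, h2]
  ring

theorem IsComb.symm {p x y : HypSpace n} {α β : ℝ} (h : IsComb p x y α β) : IsComb p y x β α :=
  ⟨by rw [h.1, add_comm], by rw [add_comm]; exact h.2⟩

/-- A point of the hyperboloid that is a nonnegative multiple of another one is equal to it. -/
theorem IsComb.eq_of_right_eq_zero {p x y : HypSpace n} {α : ℝ} (h : IsComb p x y α 0)
    (hα : 0 ≤ α) : p = x := by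
  have h1 : time p = α * time x := by linarith [h.1]
  have h2 : p = α • x := by simpa using h.2
  have hp := time_sq p
  have hn : ‖p‖ = α * ‖x‖ := by rw [h2, norm_smul, Real.norm_of_nonneg hα]
  rw [hn, h1] at hp
  have hx := time_sq x
  have : α ^ 2 = 1 := by nlinarith
  have : α = 1 := by nlinarith
  simpa [this] using h2

/-- A geodesic segment is the trace on the hyperboloid of the plane sector spanned by its end
points. Equality in the triangle inequality makes the difference of `p` and the combination with
coefficients `sinh d(p, y) / sinh d(x, y)` and `sinh d(x, p) / sinh d(x, y)` a null vector which is
orthogonal to `p`, hence zero. -/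
theorem exists_isComb_of_mem_geodesicSegment {p x y : HypSpace n} (hxy : x ≠ y)
    (h : p ∈ geodesicSegment x y) : ∃ α β, 0 ≤ α ∧ 0 ≤ β ∧ IsComb p x y α β := by
  have h : hdist x p + hdist p y = hdist x y := h
  set a := hdist x p with ha
  set b := hdist p y with hb
  have ha0 : 0 ≤ a := hdist_nonneg _ _
  have hb0 : 0 ≤ b := hdist_nonneg _ _
  have hs : 0 < Real.sinh (a + b) := Real.sinh_pos_iff.2 (h ▸ hdist_pos hxy)
  have hu : lorentz x p = Real.cosh a := (cosh_hdist x p).symm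
  have hv : lorentz p y = Real.cosh b := (cosh_hdist p y).symm
  have hw : lorentz x y = Real.cosh (a + b) := by rw [h, cosh_hdist]
  set s := Real.sinh (a + b) with hsdef
  set α := Real.sinh b / s with hα
  set β := Real.sinh a / s with hβ
  have hsα : α * s = Real.sinh b := div_mul_cancel₀ _ hs.ne'
  have hsβ : β * s = Real.sinh a := div_mul_cancel₀ _ hs.ne'
  have hα0 : 0 ≤ α := div_nonneg (Real.sinh_nonneg_iff.2 hb0) hs.le
  have hβ0 : 0 ≤ β := div_nonneg (Real.sinh_nonneg_iff.2 ha0) hs.le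
  have hadd := Real.sinh_add a b
  have hcadd := Real.cosh_add a b
  have hca := Real.cosh_sq a
  have hcb := Real.cosh_sq b
  have e1 : α * Real.cosh a + β * Real.cosh b = 1 := by
    apply mul_right_cancel₀ hs.ne'
    rw [← hsdef] at hadd
    linear_combination Real.cosh a * hsα + Real.cosh b * hsβ - hadd
  have e2 : α + β * Real.cosh (a + b) = Real.cosh a := by
    apply mul_right_cancel₀ hs.ne'
    rw [← hsdef] at hadd
    linear_combination hsα + Real.cosh (a + b) * hsβ - Real.cosh a * hadd +
      Real.sinh a * hcadd - Real.sinh b * hca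
  have e3 : α * Real.cosh (a + b) + β = Real.cosh b := by
    apply mul_right_cancel₀ hs.ne'
    rw [← hsdef] at hadd
    linear_combination Real.cosh (a + b) * hsα + hsβ - Real.cosh b * hadd +
      Real.sinh b * hcadd - Real.sinh a * hcb
  refine ⟨α, β, hα0, hβ0, ?_⟩
  -- the difference of the two vectors, in time and space coordinates
  set τ := α * time x + β * time y - time p with hτ
  set v := α • x + β • y - p with hvdef
  have ivw : ∀ w : HypSpace n, time w * τ - inner ℝ v w =
      α * lorentz x w + β * lorentz y w - lorentz p w := by
    intro w
    simp only [hτ, hvdef, lorentz, inner_sub_left, inner_add_left, real_inner_smul_left]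
    ring
  have ix : time x * τ - inner ℝ v x = 0 := by
    rw [ivw, lorentz_self, lorentz_comm y x, lorentz_comm p x, hu, hw]
    linarith
  have iy : time y * τ - inner ℝ v y = 0 := by
    rw [ivw, lorentz_self, hv, hw]
    linarith
  have ip : time p * τ - inner ℝ v p = 0 := by
    rw [ivw, lorentz_self, lorentz_comm y p, hu, hv]
    linarith
  have hq : ‖v‖ ^ 2 = τ ^ 2 := by
    have : inner ℝ v v = α * inner ℝ v x + β * inner ℝ v y - inner ℝ v p := by
      conv_lhs => rw [hvdef]
      rw [← hvdef, real_inner_comm, hvdef, inner_sub_right, inner_add_right,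
        real_inner_smul_right, real_inner_smul_right]
    rw [← real_inner_self_eq_norm_sq, this]
    linear_combination (-α) * ix - β * iy + ip + τ * hτ
  have hvτ : ‖v‖ = |τ| := by rw [← abs_norm]; exact (sq_eq_sq_iff_abs_eq_abs _ _).1 hq
  have hle : time p * |τ| ≤ |τ| * ‖p‖ := by
    rw [← hvτ, mul_comm]
    calc ‖v‖ * time p = |time p * τ| := by rw [abs_mul, abs_of_pos (time_pos p), hvτ, mul_comm]
      _ = |inner ℝ v p| := by rw [sub_eq_zero.1 ip]
      _ ≤ ‖v‖ * ‖p‖ := abs_real_inner_le_norm _ _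
  have hτ0 : |τ| = 0 := by
    by_contra hne
    have : 0 < |τ| := lt_of_le_of_ne (abs_nonneg _) (Ne.symm hne)
    nlinarith [norm_lt_time p]
  have hv0 : v = 0 := by rw [← norm_eq_zero, hvτ, hτ0]
  exact ⟨by linarith [abs_eq_zero.1 hτ0], (sub_eq_zero.1 hv0).symm⟩

/-- Hyperbolic balls, given by `lorentz z · ≤ C`, are strictly convex in the Euclidean structure of
the hyperboloid chart. -/
theorem strictConvexOn_lorentz (z : HypSpace n) : StrictConvexOn ℝ Set.univ (lorentz z) := by
  refine ⟨convex_univ, fun x _ y _ hxy a b ha hb hab => ?_⟩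
  set w := a • x + b • y with hw
  have ht : time w < a * time x + b * time y := by
    have h1 := one_lt_lorentz hxy
    rw [lorentz] at h1
    have h2 : ‖w‖ ^ 2 = a ^ 2 * ‖x‖ ^ 2 + 2 * (a * b) * inner ℝ x y + b ^ 2 * ‖y‖ ^ 2 := by
      rw [hw, norm_add_sq_real, norm_smul, norm_smul, mul_pow, mul_pow, real_inner_smul_left,
        real_inner_smul_right, Real.norm_eq_abs, Real.norm_eq_abs, sq_abs, sq_abs]
      ring
    have hx := time_sq x
    have hy := time_sq y
    have hpos := mul_pos ha hb
    have hab2 : (a + b) ^ 2 = 1 := by rw [hab, one_pow]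
    refine lt_of_pow_lt_pow_left₀ 2
      (add_nonneg (mul_nonneg ha.le (time_pos x).le) (mul_nonneg hb.le (time_pos y).le)) ?_
    have h3 : (a * time x + b * time y) ^ 2 - time w ^ 2 =
        2 * (a * b) * (time x * time y - inner ℝ x y - 1) := by
      rw [time_sq w, h2]
      linear_combination a ^ 2 * hx + b ^ 2 * hy + hab2
    nlinarith
  have hi : inner ℝ z w = a * inner ℝ z x + b * inner ℝ z y := by
    rw [hw, inner_add_right, real_inner_smul_right, real_inner_smul_right]
  simp only [lorentz, hi, smul_eq_mul]
  nlinarith [time_pos z]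

/-- Hyperbolic spheres are Lebesgue null: they lie in the frontiers of convex sets. -/
theorem volume_lorentz_sphere [NeZero n] (z : HypSpace n) (C : ℝ) :
    (volume : Measure (HypSpace n)) {x | lorentz z x = C} = 0 := by
  have hcl : IsClosed {x | lorentz z x ≤ C} := isClosed_le (continuous_lorentz z) continuous_const
  have hconv : Convex ℝ {x | lorentz z x ≤ C} := by
    simpa using (strictConvexOn_lorentz z).convexOn.convex_le C
  refine measure_mono_null (fun x hx => ?_) (hconv.addHaar_frontier _)
  rw [hcl.frontier_eq]
  refine ⟨(show lorentz z x = C from hx).le, fun hint => ?_⟩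
  -- an interior point of the ball at level `C` would be a maximum of a strictly convex function
  have hnhds : ∀ᶠ y in nhds x, lorentz z y ≤ C := mem_interior_iff_mem_nhds.1 hint
  have hadd : Filter.Tendsto (fun u : HypSpace n => x + u) (nhds 0) (nhds x) := by
    simpa using (continuous_const_add x).tendsto (0 : HypSpace n)
  have hsub : Filter.Tendsto (fun u : HypSpace n => x - u) (nhds 0) (nhds x) := by
    simpa using (continuous_const.sub continuous_id).tendsto (f := fun u => x - u) (0 : HypSpace n)
  have hev : ∀ᶠ u in nhdsWithin (0 : HypSpace n) {0}ᶜ,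
      (lorentz z (x + u) ≤ C ∧ lorentz z (x - u) ≤ C) ∧ u ≠ 0 :=
    (((hadd.eventually hnhds).and (hsub.eventually hnhds)).filter_mono nhdsWithin_le_nhds).and
      self_mem_nhdsWithin
  have : Nontrivial (HypSpace n) := inferInstance
  have : Filter.NeBot (nhdsWithin (0 : HypSpace n) {0}ᶜ) := Module.punctured_nhds_neBot ℝ _ 0
  obtain ⟨u, ⟨h1, h2⟩, hu⟩ := hev.exists
  have hne : x + u ≠ x - u := by
    intro h
    have h3 : (2 : ℝ) • u = 0 := by
      rw [two_smul, ← sub_eq_zero.2 h]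
      abel
    exact hu ((smul_eq_zero.1 h3).resolve_left two_ne_zero)
  have h3 := (strictConvexOn_lorentz z).2 (Set.mem_univ _) (Set.mem_univ _) hne
    (by norm_num : (0 : ℝ) < 1 / 2) (by norm_num : (0 : ℝ) < 1 / 2) (by norm_num)
  have h4 : (1 / 2 : ℝ) • (x + u) + (1 / 2 : ℝ) • (x - u) = x := by module
  rw [h4, show lorentz z x = C from hx, smul_eq_mul, smul_eq_mul] at h3
  linarith

end HypSpace

/-! ### Edges meet only at common end points -/

namespace RST

open HypSpace

variable {n : ℕ} {S : Set (HypSpace n)}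

theorem hdist_zero_lt_hdist_zero {x y : HypSpace n} : hdist 0 x < hdist 0 y ↔ time x < time y := by
  rw [hdist_lt_hdist, lorentz_zero_left, lorentz_zero_left]

theorem IsParent.time_lt {z a : HypSpace n} (h : IsParent S z a) : time a < time z :=
  hdist_zero_lt_hdist_zero.1 h.2.2.1

theorem IsParent.ne {z a : HypSpace n} (h : IsParent S z a) : z ≠ a := by
  rintro rfl
  exact lt_irrefl _ h.time_lt

theorem IsParent.lorentz_le {z a w : HypSpace n} (h : IsParent S z a) (hw : w ∈ insert 0 S)
    (hlt : time w < time z) : lorentz z a ≤ lorentz z w :=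
  hdist_le_hdist.1 (h.2.2.2 w hw (hdist_zero_lt_hdist_zero.2 hlt))

/-- Two edges leading to the same parent `a` meet only in `a`: otherwise one of the children lies
between `a` and the other one, and is a better parent for the latter. -/
theorem eq_of_isComb_of_common_parent {z₁ z₂ a p : HypSpace n} (hne : z₁ ≠ z₂)
    (h1 : IsParent S z₁ a) (h2 : IsParent S z₂ a) (hle : time z₁ ≤ time z₂) {α β γ δ : ℝ}
    (hα : 0 ≤ α) (hγ : 0 ≤ γ) (hδ : 0 ≤ δ) (hp1 : IsComb p z₁ a α β)
    (hp2 : IsComb p z₂ a γ δ) : p = a := by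
  rcases hγ.eq_or_lt with rfl | hγ
  · exact hp2.symm.eq_of_right_eq_zero hδ
  exfalso
  -- `Z₂ = s Z₁ + r A`
  obtain ⟨s, r, hs, hz2⟩ : ∃ s r, 0 ≤ s ∧ IsComb z₂ z₁ a s r := by
    refine ⟨α / γ, (β - δ) / γ, by positivity, ?_, ?_⟩
    · have := hp1.1.symm.trans hp2.1
      field_simp
      linarith
    · have h := hp1.2.symm.trans hp2.2
      have h' : γ • z₂ = α • z₁ + (β - δ) • a := by
        rw [sub_smul, ← add_sub_assoc, h, add_sub_cancel_right]
      rw [div_eq_inv_mul, div_eq_inv_mul, ← smul_smul, ← smul_smul, ← smul_add, ← h', smul_smul,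
        inv_mul_cancel₀ hγ.ne', one_smul]
  have ha1 := h1.time_lt
  have ha2 := h2.time_lt
  have hq : 1 = s ^ 2 + r ^ 2 + 2 * (s * r) * lorentz z₁ a := by
    have e := hz2.lorentz_left z₂
    rw [lorentz_self, lorentz_comm z₁, lorentz_comm a, hz2.lorentz_left, hz2.lorentz_left,
      lorentz_self, lorentz_self, lorentz_comm a z₁] at e
    linarith
  have hk := one_lt_lorentz h1.ne
  have ta := time_pos a
  have t1 := time_pos z₁
  have t2 := time_pos z₂
  rcases lt_trichotomy r 0 with hr | rfl | hr
  · -- `z₁` lies between `a` and `z₂`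
    have hs0 : 0 < s := by
      rcases hs.eq_or_lt with rfl | hs
      · have := hz2.1
        nlinarith
      · exact hs
    obtain ⟨s', r', hs', hr', hz1⟩ : ∃ s' r', 0 < s' ∧ 0 < r' ∧ IsComb z₁ z₂ a s' r' := by
      refine ⟨s⁻¹, -r / s, by positivity, div_pos (by linarith) hs0, ?_, ?_⟩
      · have := hz2.1
        field_simp
        linarith
      · have h' : s • z₁ = z₂ + (-r) • a := by
          conv_rhs => rw [hz2.2]
          module
        rw [div_eq_inv_mul, ← smul_smul, ← smul_add, ← h', smul_smul, inv_mul_cancel₀ hs0.ne',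
          one_smul]
    have hg := one_lt_lorentz h2.ne
    have hq' : 1 = s' ^ 2 + r' ^ 2 + 2 * (s' * r') * lorentz z₂ a := by
      have e := hz1.lorentz_left z₁
      rw [lorentz_self, lorentz_comm z₂, lorentz_comm a, hz1.lorentz_left, hz1.lorentz_left,
        lorentz_self, lorentz_self, lorentz_comm a z₂] at e
      linarith
    have hsr : s' + r' < 1 := by
      have := mul_pos hs' hr'
      by_contra hcon
      nlinarith
    have hlt : time z₁ < time z₂ := by
      have := hz1.1
      nlinarith
    have hpar := h2.lorentz_le (Set.mem_insert_of_mem _ h1.1) hlt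
    have e := hz1.lorentz_left z₂
    rw [lorentz_self, lorentz_comm z₁, lorentz_comm a] at e
    nlinarith
  · -- `z₁ = z₂`
    exact hne (hz2.eq_of_right_eq_zero hs).symm
  · have hsr : s + r ≤ 1 := by
      have := mul_nonneg hs hr.le
      by_contra hcon
      nlinarith
    have := hz2.1
    nlinarith

/-- Segments of the tree meet only at common end points. In Minkowski space the segments are plane
sectors and `lorentz w ·` is linear, so that a common point `P = α Z₁ + β A₁ = γ Z₂ + δ A₂` can be
compared with the parents by evaluating linear forms. -/
theorem eq_or_eq_of_isComb {z₁ z₂ a₁ a₂ p : HypSpace n} (hne : z₁ ≠ z₂)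
    (h1 : IsParent S z₁ a₁) (h2 : IsParent S z₂ a₂) (hle : time z₁ ≤ time z₂) {α β γ δ : ℝ}
    (hα : 0 ≤ α) (hβ : 0 ≤ β) (hγ : 0 ≤ γ) (hδ : 0 ≤ δ) (hp1 : IsComb p z₁ a₁ α β)
    (hp2 : IsComb p z₂ a₂ γ δ) : p = z₁ ∧ p = a₂ ∨ p = a₁ ∧ p = a₂ := by
  have ha1 := h1.time_lt
  have ha2 := h2.time_lt
  by_cases hcase : time z₁ ≤ time a₂
  · -- `z₁` and `a₁` are both candidates for the parent of `z₂`
    left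
    have g1 := h2.lorentz_le (Set.mem_insert_of_mem _ h1.1) (hcase.trans_lt ha2)
    have g2 := h2.lorentz_le h1.2.1 (ha1.trans_le hle)
    have eG := (hp1.lorentz_left z₂).symm.trans (hp2.lorentz_left z₂)
    rw [lorentz_self, lorentz_comm z₁, lorentz_comm a₁, lorentz_comm a₂] at eG
    have eF := hp1.1.symm.trans hp2.1
    have hg := one_lt_lorentz h2.ne
    -- the form `lorentz z₂ ·` bounds `α + β` from above, the time coordinate from below
    have hsum : α + β ≤ γ + δ := by
      by_contra hcon
      nlinarith [mul_le_mul_of_nonneg_left g1 hα, mul_le_mul_of_nonneg_left g2 hβ]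
    have t1 := time_pos z₁
    have i1 : β * (time z₁ - time a₁) + γ * (time z₂ - time z₁) + δ * (time a₂ - time z₁) ≤ 0 := by
      nlinarith
    have hβ0 : β = 0 := by
      by_contra hb
      have hb := hβ.lt_of_ne' hb
      nlinarith [mul_pos hb (sub_pos.2 ha1), mul_nonneg hγ (sub_nonneg.2 hle),
        mul_nonneg hδ (sub_nonneg.2 hcase)]
    have hγ0 : γ = 0 := by
      by_contra hb
      have hb := hγ.lt_of_ne' hb
      nlinarith [mul_nonneg hβ (sub_nonneg.2 ha1.le), mul_pos hb (sub_pos.2 (hcase.trans_lt ha2)),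
        mul_nonneg hδ (sub_nonneg.2 hcase)]
    subst hβ0 hγ0
    exact ⟨hp1.eq_of_right_eq_zero hα, hp2.symm.eq_of_right_eq_zero hδ⟩
  · -- `a₁` and `a₂` are both candidates for the parents of `z₁` and of `z₂`
    right
    have g1 := h1.lorentz_le h2.2.1 (not_le.1 hcase)
    have g2 := h2.lorentz_le h1.2.1 (ha1.trans_le hle)
    have haa : a₁ = a₂ := by
      by_contra hne'
      have hm := one_lt_lorentz hne'
      -- pairing with `a₁` and with `a₂` shows that `P` is as far from one as from the other
      have e1 := (hp1.lorentz_left a₁).symm.trans (hp2.lorentz_left a₁)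
      have e2 := (hp1.lorentz_left a₂).symm.trans (hp2.lorentz_left a₂)
      rw [lorentz_self, lorentz_comm a₂ a₁] at e1
      rw [lorentz_self] at e2
      have j1 := mul_le_mul_of_nonneg_left g1 hα
      have j2 := mul_le_mul_of_nonneg_left g2 hγ
      have j3 := mul_nonneg hβ (sub_pos.2 hm).le
      have j4 := mul_nonneg hδ (sub_pos.2 hm).le
      have hβ0 : β = 0 := by
        have : β * (lorentz a₁ a₂ - 1) = 0 := by linarith
        exact (mul_eq_zero.1 this).resolve_right (sub_pos.2 hm).ne'
      have hδ0 : δ = 0 := by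
        have : δ * (lorentz a₁ a₂ - 1) = 0 := by linarith
        exact (mul_eq_zero.1 this).resolve_right (sub_pos.2 hm).ne'
      subst hβ0 hδ0
      exact hne ((hp1.eq_of_right_eq_zero hα).symm.trans (hp2.eq_of_right_eq_zero hγ))
    subst haa
    have := eq_of_isComb_of_common_parent hne h1 h2 hle hα hγ hδ hp1 hp2
    exact ⟨this, this⟩

theorem geodesicSegment_inter_subset_of_time_le {z₁ z₂ a₁ a₂ : HypSpace n} (hne : z₁ ≠ z₂)
    (h1 : IsParent S z₁ a₁) (h2 : IsParent S z₂ a₂) (hle : time z₁ ≤ time z₂) :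
    geodesicSegment z₁ a₁ ∩ geodesicSegment z₂ a₂ ⊆ {z₁, a₁} ∩ {z₂, a₂} := by
  rintro p ⟨hp1, hp2⟩
  obtain ⟨α, β, hα, hβ, hc1⟩ := exists_isComb_of_mem_geodesicSegment h1.ne hp1
  obtain ⟨γ, δ, hγ, hδ, hc2⟩ := exists_isComb_of_mem_geodesicSegment h2.ne hp2
  rcases eq_or_eq_of_isComb hne h1 h2 hle hα hβ hγ hδ hc1 hc2 with ⟨h, h'⟩ | ⟨h, h'⟩
  · exact ⟨Or.inl h, Or.inr h'⟩
  · exact ⟨Or.inr h, Or.inr h'⟩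

/-- Planarity of the radial spanning tree, valid for every set of points in every dimension. -/
theorem geodesicSegment_inter_subset {z₁ z₂ a₁ a₂ : HypSpace n} (hne : z₁ ≠ z₂)
    (h1 : IsParent S z₁ a₁) (h2 : IsParent S z₂ a₂) :
    geodesicSegment z₁ a₁ ∩ geodesicSegment z₂ a₂ ⊆ {z₁, a₁} ∩ {z₂, a₂} := by
  rcases le_total (time z₁) (time z₂) with h | h
  · exact geodesicSegment_inter_subset_of_time_le hne h1 h2 h
  · rw [Set.inter_comm, Set.inter_comm {z₁, a₁}]
    exact geodesicSegment_inter_subset_of_time_le hne.symm h2 h1 h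

end RST

/-! ### The tree structure and finite degrees -/

namespace RST

open HypSpace

variable {n : ℕ} {S : Set (HypSpace n)}

theorem finite_setOf_time_lt (hfin : ∀ R : ℝ, (S ∩ Metric.closedBall 0 R).Finite)
    (z : HypSpace n) : {w | w ∈ insert 0 S ∧ time w < time z}.Finite := by
  refine ((hfin ‖z‖).insert 0).subset ?_
  rintro w ⟨rfl | hw, hlt⟩
  · exact Set.mem_insert _ _
  · exact Set.mem_insert_of_mem _ ⟨hw, by simpa using (time_lt_time.1 hlt).le⟩

theorem exists_isParent (hfin : ∀ R : ℝ, (S ∩ Metric.closedBall 0 R).Finite)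
    (h0 : (0 : HypSpace n) ∉ S) {z : HypSpace n} (hz : z ∈ S) : ∃ a, IsParent S z a := by
  have hz0 : time (0 : HypSpace n) < time z := by
    rw [time_lt_time, norm_zero, norm_pos_iff]
    rintro rfl
    exact h0 hz
  obtain ⟨a, ⟨ha, hlt⟩, hmin⟩ := Set.exists_min_image _ (fun w => hdist z w)
    (finite_setOf_time_lt hfin z) ⟨0, Set.mem_insert _ _, hz0⟩
  exact ⟨a, hz, ha, hdist_zero_lt_hdist_zero.2 hlt,
    fun w hw hwz => hmin w ⟨hw, hdist_zero_lt_hdist_zero.1 hwz⟩⟩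

theorem IsParent.unique (htie : ∀ z ∈ S, ∀ a ∈ insert 0 S, ∀ b ∈ insert 0 S, z ≠ a → z ≠ b →
      lorentz z a = lorentz z b → a = b) {z a b : HypSpace n} (ha : IsParent S z a)
    (hb : IsParent S z b) : a = b :=
  htie z ha.1 a ha.2.1 b hb.2.1 ha.ne hb.ne
    (le_antisymm (ha.lorentz_le hb.2.1 hb.time_lt) (hb.lorentz_le ha.2.1 ha.time_lt))

theorem reachable_root (hfin : ∀ R : ℝ, (S ∩ Metric.closedBall 0 R).Finite)
    (h0 : (0 : HypSpace n) ∉ S) (v : ↥(insert 0 S)) :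
    (graph S).Reachable v ⟨0, Set.mem_insert _ _⟩ := by
  induction hk : {w | w ∈ insert 0 S ∧ time w < time (v : HypSpace n)}.ncard using
    Nat.strong_induction_on generalizing v with
  | _ k ih =>
    obtain ⟨z, rfl | hz⟩ := v
    · exact SimpleGraph.Reachable.refl _
    · obtain ⟨a, ha⟩ := exists_isParent hfin h0 hz
      have hadj : (graph S).Adj ⟨z, Or.inr hz⟩ ⟨a, ha.2.1⟩ := Or.inl ha
      refine hadj.reachable.trans (ih _ ?_ ⟨a, ha.2.1⟩ rfl)
      rw [← hk]
      refine Set.ncard_lt_ncard ⟨fun w hw => ⟨hw.1, hw.2.trans ha.time_lt⟩, fun h => ?_⟩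
        (finite_setOf_time_lt hfin z)
      exact lt_irrefl _ (h ⟨ha.2.1, ha.time_lt⟩).2

/-- A vertex of a cycle farthest from the origin would have two parents, namely its two neighbours
in the cycle. -/
theorem isAcyclic_graph (huniq : ∀ z a b, IsParent S z a → IsParent S z b → a = b) :
    (graph S).IsAcyclic := by
  classical
  intro v c hc
  obtain ⟨u, hu, hmax⟩ := c.support.toFinset.exists_max_image (fun w => time (w : HypSpace n))
    ⟨v, by simp⟩
  rw [List.mem_toFinset] at hu
  have hc' : (c.rotate u hu).IsCycle := (SimpleGraph.Walk.isCycle_rotate hu).2 hc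
  set c' := c.rotate u hu
  have hpar : ∀ w, w ∈ c'.support → (graph S).Adj u w → IsParent S u w := by
    intro w hw hadj
    refine hadj.resolve_right fun h => ?_
    have := hmax w (List.mem_toFinset.2 ((c.mem_support_rotate_iff u hu).1 hw))
    exact absurd h.time_lt (not_lt.2 this)
  have h1 := hpar _ (c'.getVert_mem_support 1) (SimpleGraph.Walk.adj_snd hc'.not_nil)
  have h2 := hpar _ (c'.getVert_mem_support _) (SimpleGraph.Walk.adj_penultimate hc'.not_nil).symm
  exact hc'.snd_ne_penultimate (Subtype.ext (huniq _ _ _ h1 h2))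

theorem isTree_graph (hfin : ∀ R : ℝ, (S ∩ Metric.closedBall 0 R).Finite)
    (h0 : (0 : HypSpace n) ∉ S) (huniq : ∀ z a b, IsParent S z a → IsParent S z b → a = b) :
    (graph S).IsTree where
  connected := by
    have : Nonempty ↥(insert 0 S) := ⟨⟨0, Set.mem_insert _ _⟩⟩
    exact ⟨fun u v => (reachable_root hfin h0 u).trans (reachable_root hfin h0 v).symm⟩
  isAcyclic := isAcyclic_graph huniq

/-- A child `z` of `v` far away in a direction close to `ξ` is nearer to `w` than to `v` as soon as
`w` lies in the interior of the horoball centred at `ξ` with `v` on its boundary. Since the sphere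
of directions is compact, this leaves only finitely many children. -/
theorem finite_children (hfin : ∀ R : ℝ, (S ∩ Metric.closedBall 0 R).Finite)
    (hhoro : ∀ c : ℝ, 0 < c → ∀ ξ : HypSpace n, ‖ξ‖ = 1 → ∃ w ∈ S, time w - inner ℝ w ξ < c)
    (v : HypSpace n) : {z | IsParent S z v}.Finite := by
  by_contra hinf
  have hunb : ∀ k : ℕ, ∃ z, IsParent S z v ∧ (k : ℝ) < ‖z‖ := by
    intro k
    by_contra! hcon
    exact hinf ((hfin k).subset fun z hz => ⟨hz.1, by simpa using hcon z hz⟩)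
  choose z hz hzk using hunb
  have hpos : ∀ k, 0 < ‖z k‖ := fun k => k.cast_nonneg.trans_lt (hzk k)
  have hlim : Filter.Tendsto (fun k => ‖z k‖) Filter.atTop Filter.atTop :=
    Filter.tendsto_atTop_mono (fun k => (hzk k).le) tendsto_natCast_atTop_atTop
  obtain ⟨ξ, hξ, φ, hφ, hφlim⟩ := (isCompact_sphere (0 : HypSpace n) 1).tendsto_subseq
    (x := fun k => ‖z k‖⁻¹ • z k) fun k => by
      rw [mem_sphere_zero_iff_norm, norm_smul, norm_inv, norm_norm, inv_mul_cancel₀ (hpos k).ne']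
  rw [mem_sphere_zero_iff_norm] at hξ
  have hlim' := hlim.comp hφ.tendsto_atTop
  -- the Busemann function as a limit of rescaled Lorentz products
  have htime : Filter.Tendsto (fun k => ‖z (φ k)‖⁻¹ * time (z (φ k))) Filter.atTop (nhds 1) := by
    have h1 : Filter.Tendsto (fun k => √(1 + (‖z (φ k)‖⁻¹) ^ 2)) Filter.atTop (nhds √(1 + 0 ^ 2)) :=
      ((hlim'.inv_tendsto_atTop.pow 2).const_add 1).sqrt
    simp only [ne_eq, OfNat.ofNat_ne_zero, not_false_eq_true, zero_pow, add_zero,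
      Real.sqrt_one] at h1
    refine h1.congr fun k => ?_
    have hp := hpos (φ k)
    rw [Real.sqrt_eq_iff_mul_self_eq (by positivity)
      (mul_nonneg (inv_nonneg.2 hp.le) (time_pos _).le)]
    have := time_sq (z (φ k))
    field_simp
    linarith
  have hbus : ∀ w : HypSpace n, Filter.Tendsto (fun k => ‖z (φ k)‖⁻¹ * lorentz (z (φ k)) w)
      Filter.atTop (nhds (time w - inner ℝ w ξ)) := by
    intro w
    have h1 := (htime.mul_const (time w)).sub
      ((Filter.Tendsto.inner (𝕜 := ℝ) hφlim (tendsto_const_nhds (x := w))))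
    rw [one_mul, real_inner_comm] at h1
    refine h1.congr fun k => ?_
    simp only [Function.comp_apply, lorentz, real_inner_smul_left]
    ring
  obtain ⟨w, hw, hwc⟩ := hhoro (time v - inner ℝ v ξ) (by
    have := real_inner_le_norm v ξ
    rw [hξ, mul_one] at this
    linarith [norm_lt_time v]) ξ hξ
  obtain ⟨k, hk1, hk2⟩ := (((hbus w).eventually_lt (hbus v) hwc).and
    (hlim'.eventually_gt_atTop ‖w‖)).exists
  have hk3 := lt_of_mul_lt_mul_left hk1 (inv_nonneg.2 (hpos (φ k)).le)
  exact absurd ((hz (φ k)).lorentz_le (Set.mem_insert_of_mem _ hw) (time_lt_time.2 hk2))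
    (not_le.2 hk3)

theorem finite_neighborSet (hfin : ∀ R : ℝ, (S ∩ Metric.closedBall 0 R).Finite)
    (huniq : ∀ z a b, IsParent S z a → IsParent S z b → a = b)
    (hhoro : ∀ c : ℝ, 0 < c → ∀ ξ : HypSpace n, ‖ξ‖ = 1 → ∃ w ∈ S, time w - inner ℝ w ξ < c)
    (v : ↥(insert 0 S)) : ((graph S).neighborSet v).Finite := by
  have h1 : {a : HypSpace n | IsParent S v a}.Finite :=
    Set.Subsingleton.finite fun a ha b hb => huniq v a b ha hb
  refine ((h1.union (finite_children hfin hhoro v)).preimage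
    Subtype.val_injective.injOn).subset fun w hw => ?_
  exact hw

end RST

/-! ### Hyperbolic volume and horoballs -/

namespace HypSpace

variable {n : ℕ}

theorem hvol_le_volume : hvol n ≤ volume := by
  refine (withDensity_mono (g := 1) (Filter.Eventually.of_forall fun x => ?_)).trans
    withDensity_one.le
  rw [Pi.one_apply, ENNReal.ofReal_le_one, div_le_one (time_pos x)]
  exact one_le_time x

theorem smul_hvol_null {lam : ℝ≥0} {B : Set (HypSpace n)}
    (hB : (volume : Measure (HypSpace n)) B = 0) : (lam • hvol n) B = 0 := by
  rw [Measure.smul_apply, le_antisymm ((hvol_le_volume B).trans hB.le) zero_le, smul_zero]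

theorem smul_hvol_ne_top {lam : ℝ≥0} {B : Set (HypSpace n)}
    (hB : (volume : Measure (HypSpace n)) B ≠ ∞) : (lam • hvol n) B ≠ ∞ := by
  rw [Measure.smul_apply]
  exact ENNReal.mul_ne_top ENNReal.coe_ne_top (ne_top_of_le_ne_top hB (hvol_le_volume B))

instance sigmaFinite_hvol : SigmaFinite (hvol n) := by
  unfold hvol
  infer_instance

theorem le_hvol_of_time_le {B : Set (HypSpace n)} (hB : MeasurableSet B) {τ : ℝ}
    (h : ∀ x ∈ B, time x ≤ τ) : ENNReal.ofReal (1 / τ) * volume B ≤ hvol n B := by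
  rw [hvol, withDensity_apply _ hB, ← setLIntegral_const]
  refine setLIntegral_mono' hB fun x hx => ?_
  exact ENNReal.ofReal_le_ofReal (one_div_le_one_div_of_le (time_pos x) (h x hx))

/-- A point at distance at most `ρ` from the ray in the direction `ξ` lies deep in the horoballs
centred at `ξ`. -/
theorem time_sub_inner_le {w ξ : HypSpace n} (hξ : ‖ξ‖ = 1) {s ρ : ℝ} (hρ : ρ < s)
    (h : ‖w - s • ξ‖ ≤ ρ) : time w - inner ℝ w ξ ≤ (1 + ρ ^ 2) / (s - ρ) := by
  obtain ⟨v, rfl⟩ : ∃ v, w = s • ξ + v := ⟨w - s • ξ, by abel⟩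
  rw [add_sub_cancel_left] at h
  have hρ0 : 0 ≤ ρ := (norm_nonneg _).trans h
  have hi : inner ℝ (s • ξ + v) ξ = s + inner ℝ v ξ := by
    rw [inner_add_left, real_inner_smul_left, real_inner_self_eq_norm_sq, hξ]
    ring
  have hn : ‖s • ξ + v‖ ^ 2 = s ^ 2 + 2 * s * inner ℝ v ξ + ‖v‖ ^ 2 := by
    rw [norm_add_sq_real, norm_smul, hξ, real_inner_smul_left, real_inner_comm, mul_one,
      Real.norm_eq_abs, sq_abs]
    ring
  have hcs := abs_le.1 (abs_real_inner_le_norm v ξ)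
  rw [hξ, mul_one] at hcs
  have ht := time_sq (s • ξ + v)
  have htp := time_pos (s • ξ + v)
  rw [hn] at ht
  rw [hi, le_div_iff₀ (sub_pos.2 hρ)]
  have hvρ : ‖v‖ ^ 2 ≤ ρ ^ 2 := pow_le_pow_left₀ (norm_nonneg _) h 2
  set t := time (s • ξ + v)
  set q := inner ℝ v ξ
  have hprod : (t - (s + q)) * (t + (s + q)) ≤ 1 + ρ ^ 2 := by nlinarith [sq_nonneg q]
  by_cases hneg : t - (s + q) ≤ 0
  · nlinarith [sq_nonneg ρ]
  · nlinarith

/-- The directions are covered by polynomially many small caps, obtained from a grid. -/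
theorem exists_sphere_net (n : ℕ) {k : ℕ} (hk : 0 < k) :
    ∃ T : Finset (HypSpace n), T.card ≤ (2 * k + 1) ^ n ∧ (∀ η ∈ T, ‖η‖ = 1) ∧
      ∀ ξ : HypSpace n, ‖ξ‖ = 1 → ∃ η ∈ T, ‖ξ - η‖ ≤ n / k := by
  classical
  have hk' : (0 : ℝ) < k := by exact_mod_cast hk
  let cell : HypSpace n → Fin n → ℤ := fun ξ i => ⌊ξ i * k⌋
  let K : Finset (Fin n → ℤ) := Fintype.piFinset fun _ => Finset.Icc (-k : ℤ) k
  -- a direction in the grid cell `a`, if there is one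
  let g : (Fin n → ℤ) → HypSpace n := fun a =>
    if h : ∃ ξ : HypSpace n, ‖ξ‖ = 1 ∧ cell ξ = a then h.choose else 0
  have hg : ∀ ξ : HypSpace n, ‖ξ‖ = 1 → ‖g (cell ξ)‖ = 1 ∧ cell (g (cell ξ)) = cell ξ := by
    intro ξ hξ
    have h : ∃ ξ' : HypSpace n, ‖ξ'‖ = 1 ∧ cell ξ' = cell ξ := ⟨ξ, hξ, rfl⟩
    simp only [g, dif_pos h]
    exact h.choose_spec
  refine ⟨(K.image g).filter fun η => ‖η‖ = 1, ?_, fun η hη => (Finset.mem_filter.1 hη).2,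
    fun ξ hξ => ⟨g (cell ξ), ?_, ?_⟩⟩
  · refine (Finset.card_filter_le _ _).trans (Finset.card_image_le.trans ?_)
    have : (k + 1 + k : ℤ).toNat = 2 * k + 1 := by omega
    simp [K, this]
  · refine Finset.mem_filter.2 ⟨Finset.mem_image_of_mem _ ?_, (hg ξ hξ).1⟩
    refine Fintype.mem_piFinset.2 fun i => ?_
    have hi : |ξ i| ≤ 1 := by
      rw [← hξ]
      exact PiLp.norm_apply_le ξ i
    rw [abs_le] at hi
    rw [Finset.mem_Icc]
    refine ⟨Int.le_floor.2 ?_, Int.floor_le_iff.2 ?_⟩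
    · push_cast
      nlinarith
    · push_cast
      nlinarith
  · have hcell := (hg ξ hξ).2
    set η := g (cell ξ)
    have hi : ∀ i, |(ξ - η) i| ≤ 1 / k := by
      intro i
      have h1 : ⌊η i * k⌋ = ⌊ξ i * k⌋ := congrFun hcell i
      have h2 := Int.abs_sub_lt_one_of_floor_eq_floor h1
      rw [abs_sub_comm, ← sub_mul, abs_mul, abs_of_pos hk'] at h2
      rw [le_div_iff₀ hk']
      exact h2.le
    calc ‖ξ - η‖ ≤ ∑ i, |(ξ - η) i| := by
          rw [EuclideanSpace.norm_eq]
          refine Real.sqrt_le_iff.2 ⟨Finset.sum_nonneg fun i _ => abs_nonneg _, ?_⟩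
          exact Finset.sum_sq_le_sq_sum_of_nonneg fun i _ => abs_nonneg _
      _ ≤ ∑ _i : Fin n, 1 / (k : ℝ) := Finset.sum_le_sum fun i _ => hi i
      _ = n / k := by simp [div_eq_mul_inv]

/-- A tube around a piece of the ray in the direction `η`: disjoint balls of radius `m`, with
centres at Euclidean distances between `m ^ 4` and `5 * m ^ 4` from the origin. The width of the
tube is small compared with the square root of its distance to the origin, so that it is contained
in a small horoball, while the volume of the tube grows with `m`. -/
def tube (η : HypSpace n) (m : ℕ) : Set (HypSpace n) :=
  ⋃ j ∈ Finset.range (m ^ 3), Metric.ball ((m ^ 4 + 4 * j * m : ℝ) • η) m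

theorem measurableSet_tube (η : HypSpace n) (m : ℕ) : MeasurableSet (tube η m) :=
  Finset.measurableSet_biUnion _ fun _ _ => measurableSet_ball

theorem exists_of_mem_tube {η w : HypSpace n} {m : ℕ} (hw : w ∈ tube η m) :
    ∃ s : ℝ, m ^ 4 ≤ s ∧ s ≤ 5 * m ^ 4 ∧ ‖w - s • η‖ ≤ m := by
  simp only [tube, Set.mem_iUnion, Finset.mem_range, Metric.mem_ball, dist_eq_norm] at hw
  obtain ⟨j, hj, hw⟩ := hw
  refine ⟨_, ?_, ?_, hw.le⟩
  · have : (0 : ℝ) ≤ 4 * j * m := by positivity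
    linarith
  · have h1 : (j : ℝ) ≤ m ^ 3 := by exact_mod_cast hj.le
    have h2 : (j : ℝ) * m ≤ m ^ 3 * m := mul_le_mul_of_nonneg_right h1 (Nat.cast_nonneg m)
    linarith [show (m : ℝ) ^ 3 * m = m ^ 4 by ring]

theorem norm_le_of_mem_tube {η w : HypSpace n} (hη : ‖η‖ = 1) {m : ℕ} (hw : w ∈ tube η m) :
    ‖w‖ ≤ 6 * m ^ 4 := by
  obtain ⟨s, hs1, hs2, hws⟩ := exists_of_mem_tube hw
  have h1 : ‖w‖ ≤ ‖w - s • η‖ + ‖s • η‖ := by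
    simpa using norm_add_le (w - s • η) (s • η)
  have hs0 : 0 ≤ s := le_trans (by positivity) hs1
  rw [norm_smul, hη, mul_one, Real.norm_of_nonneg hs0] at h1
  have hm : (m : ℝ) ≤ m ^ 4 := by exact_mod_cast Nat.le_self_pow (by norm_num) m
  linarith

theorem volume_tube {η : HypSpace n} (hη : ‖η‖ = 1) (m : ℕ) :
    (volume : Measure (HypSpace n)) (tube η m) =
      ENNReal.ofReal (m ^ 3 * m ^ n) * volume (Metric.ball (0 : HypSpace n) 1) := by
  rcases Nat.eq_zero_or_pos m with rfl | hm
  · simp [tube]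
  have hm' : (0 : ℝ) < m := by exact_mod_cast hm
  rw [tube, measure_biUnion_finset]
  · have hb : ∀ j ∈ Finset.range (m ^ 3), (volume : Measure (HypSpace n))
        (Metric.ball ((m ^ 4 + 4 * j * m : ℝ) • η) m) =
          ENNReal.ofReal (m ^ n) * volume (Metric.ball (0 : HypSpace n) 1) := by
      intro j _
      rw [Measure.addHaar_ball_of_pos _ _ hm']
      simp
    rw [Finset.sum_congr rfl hb, Finset.sum_const, Finset.card_range, nsmul_eq_mul, ← mul_assoc,
      ENNReal.ofReal_mul (by positivity)]
    congr 2
    rw [← Nat.cast_pow, ENNReal.ofReal_natCast]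
  · intro i _ j _ hij
    refine Metric.ball_disjoint_ball ?_
    rw [dist_eq_norm, ← sub_smul, norm_smul, hη, mul_one, Real.norm_eq_abs]
    have h1 : (1 : ℝ) ≤ |(i : ℝ) - j| := by
      have : (1 : ℤ) ≤ |(i : ℤ) - j| := Int.one_le_abs (sub_ne_zero.2 (by exact_mod_cast hij))
      exact_mod_cast this
    rw [show (m ^ 4 + 4 * i * m - (m ^ 4 + 4 * j * m) : ℝ) = (4 * m) * (i - j) by ring, abs_mul,
      abs_of_pos (by positivity)]
    nlinarith
  · exact fun _ _ => measurableSet_ball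

theorem volume_tube_ne_top {η : HypSpace n} (hη : ‖η‖ = 1) (m : ℕ) :
    (volume : Measure (HypSpace n)) (tube η m) ≠ ∞ := by
  rw [volume_tube hη]
  exact ENNReal.mul_ne_top ENNReal.ofReal_ne_top measure_ball_lt_top.ne

/-- In dimension at least two, the hyperbolic volume of the tubes grows at least linearly. -/
theorem le_smul_hvol_tube (hn : 2 ≤ n) {η : HypSpace n} (hη : ‖η‖ = 1) {m : ℕ} (hm : 1 ≤ m)
    (lam : ℝ≥0) :
    lam * (volume (Metric.ball (0 : HypSpace n) 1)).toReal / 7 * m ≤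
      ((lam • hvol n) (tube η m)).toReal := by
  have hm' : (1 : ℝ) ≤ m := by exact_mod_cast hm
  -- on the tube the density of the hyperbolic volume is at least `1 / (7 * m ^ 4)`
  have h1 := le_hvol_of_time_le (measurableSet_tube η m) (τ := 7 * m ^ 4) fun x hx => by
    have hx := norm_le_of_mem_tube hη hx
    have hm4 : (1 : ℝ) ≤ m ^ 4 := one_le_pow₀ hm'
    have := time_sq x
    have h0 := norm_nonneg x
    refine le_of_sq_le_sq (a := time x) ?_ (by positivity)
    nlinarith
  rw [volume_tube hη] at h1
  have h2 := ENNReal.toReal_mono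
    (ne_top_of_le_ne_top (volume_tube_ne_top hη m) (hvol_le_volume _)) h1
  rw [ENNReal.toReal_mul, ENNReal.toReal_mul, ENNReal.toReal_ofReal (by positivity),
    ENNReal.toReal_ofReal (by positivity)] at h2
  rw [Measure.smul_apply, ENNReal.smul_def, smul_eq_mul, ENNReal.toReal_mul, ENNReal.coe_toReal,
    mul_div_assoc, mul_assoc]
  refine mul_le_mul_of_nonneg_left (le_trans ?_ h2) lam.2
  set κ := (volume (Metric.ball (0 : HypSpace n) 1)).toReal
  have hκ : 0 ≤ κ := ENNReal.toReal_nonneg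
  have hpow : (m : ℝ) ^ 2 ≤ m ^ n := pow_le_pow_right₀ hm' hn
  rw [← mul_assoc, one_div, inv_mul_eq_div, div_mul_eq_mul_div, div_mul_eq_mul_div,
    div_le_div_iff₀ (by positivity) (by positivity)]
  have h3 : κ * (m : ℝ) ^ 3 * m ^ 2 ≤ κ * m ^ 3 * m ^ n :=
    mul_le_mul_of_nonneg_left hpow (by positivity)
  linarith [show κ * m * (7 * (m : ℝ) ^ 4) = 7 * (κ * m ^ 3 * m ^ 2) by ring]

/-- The tube in the direction `η` is contained in all horoballs of a given size whose centres are
close to `η`. -/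
theorem eventually_tube_subset_horoball (n : ℕ) {c : ℝ} (hc : 0 < c) :
    ∀ᶠ m : ℕ in Filter.atTop, ∀ ξ η w : HypSpace n, ‖ξ‖ = 1 → ‖ξ - η‖ ≤ n / (m ^ 3 : ℕ) →
      w ∈ tube η m → time w - inner ℝ w ξ < c := by
  -- the tube stays within distance `m + 5 * m ^ 4 * (n / m ^ 3)` of the ray in the direction `ξ`
  set K : ℝ := 5 * n + 1 with hK
  have hK1 : 1 ≤ K := by
    have : (0 : ℝ) ≤ n := Nat.cast_nonneg n
    linarith
  have hlim := tendsto_natCast_atTop_atTop (R := ℝ)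
  filter_upwards [hlim.eventually_ge_atTop (2 * K), hlim.eventually_gt_atTop (4 * K ^ 2 / c)]
    with m hm1 hm2 ξ η w hξ hηξ hw
  have hm : (1 : ℝ) ≤ m := by linarith
  obtain ⟨s, hs1, hs2, hws⟩ := exists_of_mem_tube hw
  have hs0 : 0 ≤ s := le_trans (by positivity) hs1
  have hdist : ‖w - s • ξ‖ ≤ K * m := by
    have h1 : ‖w - s • ξ‖ ≤ ‖w - s • η‖ + ‖s • (ξ - η)‖ := by
      have : w - s • ξ = (w - s • η) - s • (ξ - η) := by module
      rw [this]
      exact norm_sub_le _ _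
    rw [norm_smul, Real.norm_of_nonneg hs0] at h1
    have h2 : s * ‖ξ - η‖ ≤ 5 * m ^ 4 * (n / (m ^ 3 : ℕ)) :=
      mul_le_mul hs2 hηξ (norm_nonneg _) (by positivity)
    have h3 : (5 * m ^ 4 * (n / (m ^ 3 : ℕ)) : ℝ) = 5 * n * m := by
      push_cast
      field_simp
    rw [h3] at h2
    rw [hK]
    linarith
  have hm4 : 2 * K * (m : ℝ) ^ 3 ≤ m ^ 4 := by
    rw [pow_succ' (m : ℝ) 3]
    exact mul_le_mul_of_nonneg_right hm1 (by positivity)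
  have hm3 : (m : ℝ) ≤ m ^ 3 := by exact_mod_cast Nat.le_self_pow (by norm_num) m
  have hKm : K * m ≤ K * (m : ℝ) ^ 3 := mul_le_mul_of_nonneg_left hm3 (by linarith)
  have hs : K * m < s := by nlinarith
  refine (time_sub_inner_le hξ hs hdist).trans_lt ?_
  rw [div_lt_iff₀ (sub_pos.2 hs)]
  rw [div_lt_iff₀ hc] at hm2
  have h5 : K * (m : ℝ) ^ 3 ≤ s - K * m := by linarith
  have h6 : 1 + (K * m) ^ 2 ≤ 2 * (K * m) ^ 2 := by
    have : 1 ≤ (K * (m : ℝ)) ^ 2 := one_le_pow₀ (by nlinarith)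
    linarith
  calc 1 + (K * m) ^ 2 ≤ 2 * (K * m) ^ 2 := h6
    _ ≤ 4 * K ^ 2 * (K * m ^ 2) := by
        have : (0 : ℝ) ≤ K ^ 2 * m ^ 2 := by positivity
        nlinarith
    _ < (m * c) * (K * m ^ 2) := mul_lt_mul_of_pos_right hm2 (by positivity)
    _ = c * (K * m ^ 3) := by ring
    _ ≤ c * (s - K * m) := mul_le_mul_of_nonneg_left h5 hc.le

end HypSpace

/-! ### Almost sure properties of the Poisson process in hyperbolic space -/

theorem tendsto_polynomial_mul_exp_neg (n : ℕ) {a : ℝ} (ha : 0 < a) :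
    Filter.Tendsto (fun m : ℕ => ((2 * m ^ 3 + 1 : ℕ) : ℝ) ^ n * Real.exp (-(a * m)))
      Filter.atTop (nhds 0) := by
  have h1 : Filter.Tendsto (fun m : ℕ => a * (m : ℝ)) Filter.atTop Filter.atTop :=
    tendsto_natCast_atTop_atTop.const_mul_atTop ha
  have h2 := ((Real.tendsto_pow_mul_exp_neg_atTop_nhds_zero (3 * n)).comp h1).const_mul
    (3 ^ n / a ^ (3 * n))
  rw [mul_zero] at h2
  refine squeeze_zero' (Filter.Eventually.of_forall fun m => by positivity) ?_ h2
  filter_upwards [Filter.eventually_ge_atTop 1] with m hm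
  have hm' : (1 : ℝ) ≤ m := by exact_mod_cast hm
  have h3 : ((2 * m ^ 3 + 1 : ℕ) : ℝ) ≤ 3 * m ^ 3 := by
    push_cast
    linarith [one_le_pow₀ (n := 3) hm']
  calc ((2 * m ^ 3 + 1 : ℕ) : ℝ) ^ n * Real.exp (-(a * m))
      ≤ (3 * (m : ℝ) ^ 3) ^ n * Real.exp (-(a * m)) := by gcongr
    _ = _ := by
      simp only [Function.comp_apply, mul_pow, ← pow_mul]
      field_simp

namespace IsPoissonPointProcess

open HypSpace

variable {Ω : Type*} [MeasurableSpace Ω] {P : Measure Ω} {n : ℕ} {lam : ℝ≥0}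
  {N : Ω → Set (HypSpace n)}

theorem ae_finite_inter_closedBall (hN : IsPoissonPointProcess P (lam • hvol n) N) :
    ∀ᵐ ω ∂P, ∀ R : ℝ, (N ω ∩ Metric.closedBall 0 R).Finite := by
  have h : ∀ k : ℕ, ∀ᵐ ω ∂P, (N ω ∩ Metric.closedBall 0 (k : ℝ)).Finite := fun k =>
    hN.ae_finite_inter measurableSet_closedBall (smul_hvol_ne_top measure_closedBall_lt_top.ne)
  filter_upwards [ae_all_iff.2 h] with ω hω R
  obtain ⟨k, hk⟩ := exists_nat_ge R
  exact (hω k).subset (Set.inter_subset_inter_right _ (Metric.closedBall_subset_closedBall hk))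

theorem ae_zero_notMem [NeZero n] [IsProbabilityMeasure P]
    (hN : IsPoissonPointProcess P (lam • hvol n) N) : ∀ᵐ ω ∂P, (0 : HypSpace n) ∉ N ω := by
  have h0 : (lam • hvol n) {(0 : HypSpace n)} = 0 := smul_hvol_null (measure_singleton 0)
  have h := hN.prob_nonempty_le (measurableSet_singleton (0 : HypSpace n))
  rw [h0, nonpos_iff_eq_zero, measure_eq_zero_iff_ae_notMem] at h
  filter_upwards [h] with ω hω hmem
  refine hω (show (N ω ∩ {0}).encard ≠ 0 from ?_)
  rw [ne_eq, Set.encard_eq_zero, ← ne_eq, ← Set.nonempty_iff_ne_empty]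
  exact ⟨0, hmem, rfl⟩

/-- Almost surely, no point of the process is at the same distance from two other points of the
process, or from the origin and another point. -/
theorem ae_no_tie [NeZero n] [IsProbabilityMeasure P]
    (hN : IsPoissonPointProcess P (lam • hvol n) N) :
    ∀ᵐ ω ∂P, ∀ z ∈ N ω, ∀ a ∈ insert 0 (N ω), ∀ b ∈ insert 0 (N ω), z ≠ a → z ≠ b →
      lorentz z a = lorentz z b → a = b := by
  have hco : ∀ {k : ℕ} (i : Fin k), Continuous fun x : Fin k → HypSpace n => x i :=
    fun i => continuous_apply i
  have hclosed3 : IsClosed {x : Fin 3 → HypSpace n | lorentz (x 0) (x 1) = lorentz (x 0) (x 2)} :=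
    isClosed_eq (continuous_lorentz_comp (hco 0) (hco 1)) (continuous_lorentz_comp (hco 0) (hco 2))
  have hclosed2 : IsClosed {x : Fin 2 → HypSpace n | lorentz (x 0) (x 1) = lorentz (x 0) 0} :=
    isClosed_eq (continuous_lorentz_comp (hco 0) (hco 1))
      (continuous_lorentz_comp (hco 0) continuous_const)
  have h3 := hN.ae_notMem_of_pi_null
    (Measure.pi_null_of_snoc_null hclosed3.measurableSet fun x =>
      smul_hvol_null (measure_mono_null (fun y hy => Eq.symm hy)
        (volume_lorentz_sphere (x 0) (lorentz (x 0) (x 1)))))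
  have h2 := hN.ae_notMem_of_pi_null
    (Measure.pi_null_of_snoc_null hclosed2.measurableSet fun x =>
      smul_hvol_null (measure_mono_null (fun y hy => hy)
        (volume_lorentz_sphere (x 0) (lorentz (x 0) 0))))
  have hpair : ∀ {z a : HypSpace n}, z ≠ a → Function.Injective ![z, a] := by
    intro z a hza i j hij
    fin_cases i <;> fin_cases j <;> simp_all
  filter_upwards [h2, h3] with ω h2 h3 z hz a ha b hb hza hzb heq
  by_contra hab
  rcases ha with rfl | ha <;> rcases hb with rfl | hb
  · exact hab rfl
  · refine h2 ![z, b] (hpair hzb) (fun i => ?_) heq.symm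
    fin_cases i <;> simpa
  · refine h2 ![z, a] (hpair hza) (fun i => ?_) heq
    fin_cases i <;> simpa
  · refine h3 ![z, a, b] (fun i j hij => ?_) (fun i => ?_) heq
    · fin_cases i <;> fin_cases j <;> simp_all
    · fin_cases i <;> simpa

/-- Almost surely, every horoball contains points of the process. All horoballs of a given size are
treated simultaneously: polynomially many tubes of parameter `m` suffice to have one inside each
of them, and a tube is empty with exponentially small probability. -/
theorem ae_exists_mem_horoball [IsProbabilityMeasure P] (hn : 2 ≤ n) (hlam : 0 < lam)
    (hN : IsPoissonPointProcess P (lam • hvol n) N) :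
    ∀ᵐ ω ∂P, ∀ c : ℝ, 0 < c → ∀ ξ : HypSpace n, ‖ξ‖ = 1 →
      ∃ w ∈ N ω, time w - inner ℝ w ξ < c := by
  set a : ℝ := lam * (volume (Metric.ball (0 : HypSpace n) 1)).toReal / 7 with ha
  have ha0 : 0 < a := by
    have : 0 < (volume (Metric.ball (0 : HypSpace n) 1)).toReal :=
      ENNReal.toReal_pos (Metric.measure_ball_pos _ _ one_pos).ne' measure_ball_lt_top.ne
    have hl : (0 : ℝ) < lam := hlam
    positivity
  have hlim := ENNReal.tendsto_ofReal (tendsto_polynomial_mul_exp_neg n ha0)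
  rw [ENNReal.ofReal_zero] at hlim
  have hc : ∀ c : ℝ, 0 < c → P {ω | ∃ ξ : HypSpace n, ‖ξ‖ = 1 ∧
      ∀ w ∈ N ω, c ≤ time w - inner ℝ w ξ} = 0 := by
    intro c hc
    refine le_antisymm (ge_of_tendsto hlim ?_) zero_le
    filter_upwards [eventually_tube_subset_horoball n hc, Filter.eventually_ge_atTop 1]
      with m hm hm1
    obtain ⟨T, hTcard, hTnorm, hT⟩ := exists_sphere_net n (k := m ^ 3) (by positivity)
    have hsub : {ω | ∃ ξ : HypSpace n, ‖ξ‖ = 1 ∧ ∀ w ∈ N ω, c ≤ time w - inner ℝ w ξ} ⊆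
        ⋃ η ∈ T, {ω | (N ω ∩ tube η m).encard = 0} := by
      rintro ω ⟨ξ, hξ, hω⟩
      obtain ⟨η, hη, hξη⟩ := hT ξ hξ
      refine Set.mem_biUnion hη ?_
      rw [Set.mem_ofPred_eq, Set.encard_eq_zero, Set.eq_empty_iff_forall_notMem]
      rintro w ⟨hwN, hw⟩
      exact not_lt.2 (hω w hwN) (hm ξ η w hξ hξη hw)
    refine (measure_mono hsub).trans ((measure_biUnion_finset_le _ _).trans ?_)
    have hterm : ∀ η ∈ T, P {ω | (N ω ∩ tube η m).encard = 0} ≤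
        ENNReal.ofReal (Real.exp (-(a * m))) := by
      intro η hη
      rw [hN.prob_count_eq_zero (measurableSet_tube η m)
        (smul_hvol_ne_top (volume_tube_ne_top (hTnorm η hη) m))]
      exact ENNReal.ofReal_le_ofReal (Real.exp_le_exp.2
        (neg_le_neg (le_smul_hvol_tube hn (hTnorm η hη) hm1 lam)))
    refine (Finset.sum_le_sum hterm).trans ?_
    rw [Finset.sum_const, nsmul_eq_mul, ENNReal.ofReal_mul (by positivity), ← Nat.cast_pow,
      ENNReal.ofReal_natCast]
    gcongr
  have hall : ∀ k : ℕ, ∀ᵐ ω ∂P, ¬ ∃ ξ : HypSpace n, ‖ξ‖ = 1 ∧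
      ∀ w ∈ N ω, (1 / (k + 1) : ℝ) ≤ time w - inner ℝ w ξ := fun k =>
    measure_eq_zero_iff_ae_notMem.1 (hc _ (by positivity))
  filter_upwards [ae_all_iff.2 hall] with ω hω c hc ξ hξ
  obtain ⟨k, hk⟩ := exists_nat_one_div_lt hc
  have h := hω k
  push Not at h
  obtain ⟨w, hw, hwk⟩ := h ξ hξ
  exact ⟨w, hw, hwk.trans hk⟩

end IsPoissonPointProcess

/-! ### The radial spanning tree of the Poisson process -/

theorem mainTheorem7 (d : ℕ) (hd : 1 ≤ d) (lam : ℝ≥0) (hlam : 0 < lam)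
    {Ω : Type*} [MeasurableSpace Ω] (P : Measure Ω) [IsProbabilityMeasure P]
    (N : Ω → Set (HypSpace (d + 1)))
    (hN : IsPoissonPointProcess P (lam • HypSpace.hvol (d + 1)) N) :
    ∀ᵐ ω ∂P,
      -- the parent is well defined
      (∀ z ∈ N ω, ∃! a, RST.IsParent (N ω) z a) ∧
      -- the graph is a tree, and every vertex has finite degree
      (RST.graph (N ω)).IsTree ∧
      (∀ v, ((RST.graph (N ω)).neighborSet v).Finite) ∧
      -- in dimension two, geodesic edges of distinct vertices meet at most at a common endpoint
      (d = 1 → ∀ z₁ ∈ N ω, ∀ z₂ ∈ N ω, z₁ ≠ z₂ →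
        ∀ a₁ a₂, RST.IsParent (N ω) z₁ a₁ → RST.IsParent (N ω) z₂ a₂ →
          HypSpace.geodesicSegment z₁ a₁ ∩ HypSpace.geodesicSegment z₂ a₂ ⊆
            {z₁, a₁} ∩ {z₂, a₂}) := by
  filter_upwards [hN.ae_finite_inter_closedBall, hN.ae_zero_notMem, hN.ae_no_tie,
    hN.ae_exists_mem_horoball (by omega) hlam] with ω hfin h0 htie hhoro
  have huniq : ∀ z a b, RST.IsParent (N ω) z a → RST.IsParent (N ω) z b → a = b :=
    fun z a b ha hb => ha.unique htie hb
  refine ⟨fun z hz => ?_, RST.isTree_graph hfin h0 huniq, RST.finite_neighborSet hfin huniq hhoro,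
    fun _ z₁ _ z₂ _ hne a₁ a₂ h1 h2 => RST.geodesicSegment_inter_subset hne h1 h2⟩
  obtain ⟨a, ha⟩ := RST.exists_isParent hfin h0 hz
  exact ⟨a, ha, fun b hb => huniq z b a hb ha⟩
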